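/- Let $R$ be a (commutative Noetherian) Cohen–Macaulay local ring and let $M$ be a nonzero finitely generated $R$-module satisfying Serre's condition $(S_3)$, that is, $\operatorname{depth}_{R_{\mathfrak q}}(M_{\mathfrak q}) \geq \min\{3, \dim R_{\mathfrak q}\}$ for every $\mathfrak q \in \operatorname{Supp}_R(M)$. Assume that there is a prime ideal $\mathfrak p$ of $R$ with $\operatorname{height}(\mathfrak p) = 2$ and $\mathfrak p \notin \operatorname{Supp}_R(M)$. Then $M$ is not Tor-rigid: it is not the case that, for every finitely generated $R$-module $N$ and every integer $n \geq 0$ with $\operatorname{Tor}_n^R(M,N) = 0$, one has $\operatorname{Tor}_j^R(M,N) = 0$ for all $j \geq n$. -/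

import Mathlib

open CategoryTheory CategoryTheory.Limits

universe u

/-- The depth of a finitely generated module `M` over a Noetherian local ring `R`: the supremum of
the lengths of the `M`-regular sequences contained in the maximal ideal. For `M ≠ 0` finitely
generated, the requirement that `M` differs from `(r₁, …, rₙ)M` holds automatically, by Nakayama's
lemma. For `M = 0` every sequence in the maximal ideal counts, so that the depth of the zero module
is `∞`. -/
noncomputable def moduleDepth (R M : Type*) [CommRing R] [IsLocalRing R]
    [AddCommGroup M] [Module R M] : ℕ∞ :=
  ⨆ rs ∈ {rs : List R | (∀ r ∈ rs, r ∈ IsLocalRing.maximalIdeal R) ∧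
    RingTheory.Sequence.IsWeaklyRegular M rs}, (rs.length : ℕ∞)

/-- A Cohen–Macaulay local ring: a Noetherian local ring whose depth equals its Krull
dimension. -/
structure IsCohenMacaulayLocal (R : Type*) [CommRing R] [IsLocalRing R] : Prop where
  isNoetherianRing : IsNoetherianRing R
  depth_eq_dim : (moduleDepth R R : WithBot ℕ∞) = ringKrullDim R

/-- Serre's condition `(Sₙ)`: for every prime `𝔭` in the support of `M`, the depth of the
`R_𝔭`-module `M_𝔭` is at least `min {n, dim R_𝔭}`. -/
def SatisfiesSerre (R M : Type*) [CommRing R] [AddCommGroup M] [Module R M] (n : ℕ) : Prop :=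
  ∀ p ∈ Module.support R M,
    min (n : WithBot ℕ∞) (ringKrullDim (Localization.AtPrime p.asIdeal)) ≤
      (moduleDepth (Localization.AtPrime p.asIdeal)
        (LocalizedModule p.asIdeal.primeCompl M) : WithBot ℕ∞)

/-- `M` is Tor-rigid if, whenever `Tor_n(M, N) = 0` for some finitely generated module `N` and some
`n ≥ 0`, one has `Tor_j(M, N) = 0` for all `j ≥ n`. -/
def IsTorRigid (R M : Type u) [CommRing R] [AddCommGroup M] [Module R M] : Prop :=
  ∀ (N : Type u) [AddCommGroup N] [Module R N] [Module.Finite R N] (n : ℕ),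
    IsZero (((Tor (ModuleCat.{u} R) n).obj (ModuleCat.of R M)).obj (ModuleCat.of R N)) →
      ∀ j : ℕ, n ≤ j →
        IsZero (((Tor (ModuleCat.{u} R) j).obj (ModuleCat.of R M)).obj (ModuleCat.of R N))

/-! Let `M` be Tor-rigid and `x` regular on `M`. Resolve `R/xR` starting from `x : R ⟶ R`.
Injectivity of `x` on `M` gives `Tor₁(M, R/xR) = 0`, so rigidity gives `Tor₂(M, R/xR) = 0`. This
forces `M ⊗ (0 : x) = 0`, hence `(0 : x) = 0` by Nakayama: `x` is regular on `R`
(`IsTorRigid.mem_nonZeroDivisors`). A minimal prime `q ≤ p` consists of zero divisors of `R`, hence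
of `M`, so prime avoidance puts `q` inside an associated prime of `M`. By Serre's condition that
prime is minimal, hence equal to `q`. Thus `Ann M ≤ q ≤ p`, contradicting `p ∉ Supp M`. -/

namespace CategoryTheory.ProjectiveResolution

open Projective

variable {C : Type*} [Category* C] [Abelian C] [EnoughProjectives C] {P₁ P₀ : C} (f : P₁ ⟶ P₀)

lemma d_comp_self : Projective.d f ≫ f = 0 :=
  (Category.assoc _ _ _).trans ((congrArg _ (kernel.condition f)).trans comp_zero)

/-- The complex `⋯ ⟶ P₂ ⟶ P₁ ⟶ P₀` extending `f : P₁ ⟶ P₀` by iterated syzygies. -/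
noncomputable def ofPresentationComplex : ChainComplex C ℕ :=
  ChainComplex.mk' P₀ P₁ f (fun g => ⟨_, Projective.d g, d_comp_self g⟩)

lemma ofPresentationComplex_d_one_zero : (ofPresentationComplex f).d 1 0 = f :=
  ChainComplex.mk'_d_1_0 ..

lemma ofPresentationComplex_d_two_one : (ofPresentationComplex f).d 2 1 = Projective.d f :=
  ChainComplex.mk_d_2_1 ..

lemma ofPresentationComplex_exactAt_succ (n : ℕ) :
    (ofPresentationComplex f).ExactAt (n + 1) := by
  rw [HomologicalComplex.exactAt_iff' _ (n + 1 + 1) (n + 1) n (by simp) (by simp)]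
  -- The successive stages of the recursion behind `ChainComplex.mk'`; each is exact because its new
  -- map covers the kernel of the previous one.
  let S : ℕ → ShortComplex C :=
    ChainComplex.mkAux P₀ P₁ (syzygies f) f (Projective.d f) (d_comp_self f)
      (fun S => ⟨syzygies S.f, Projective.d S.f, d_comp_self S.f⟩)
  have hS : (S n).Exact := by
    match n with
    | 0 => exact exact_d_f f
    | n + 1 => exact exact_d_f (S n).f
  refine ShortComplex.exact_of_iso (ShortComplex.isoMk (S₁ := S n)
    (S₂ := (ofPresentationComplex f).sc' (n + 1 + 1) (n + 1) n)
    (Iso.refl _) (Iso.refl _) (Iso.refl _) ?_ ?_) hS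
  · exact (Category.id_comp _).trans ((ChainComplex.of_d (fun n => (S n).X₃)
      (fun n => (S n).g) (n + 1)).trans (Category.comp_id _).symm)
  · exact (Category.id_comp _).trans ((ChainComplex.of_d (fun n => (S n).X₃)
      (fun n => (S n).g) n).trans (Category.comp_id _).symm)

instance [hP₁ : Projective P₁] [hP₀ : Projective P₀] (n : ℕ) :
    Projective ((ofPresentationComplex f).X n) := by
  obtain (_ | _ | _ | n) := n
  · exact hP₀
  · exact hP₁
  all_goals apply Projective.projective_over

/-- A morphism between projective objects extends to a projective resolution of its cokernel. -/
noncomputable def ofPresentation [Projective P₁] [Projective P₀] :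
    ProjectiveResolution (cokernel f) where
  complex := ofPresentationComplex f
  π := (ChainComplex.toSingle₀Equiv _ _).symm ⟨cokernel.π f, by
    rw [ofPresentationComplex_d_one_zero]; exact cokernel.condition f⟩
  quasiIso := ⟨fun n => by
    cases n
    · rw [ChainComplex.quasiIsoAt₀_iff, ShortComplex.quasiIso_iff_of_zeros']
      · refine (ShortComplex.exact_and_epi_g_iff_of_iso ?_).2
          ⟨ShortComplex.exact_cokernel f, by dsimp; infer_instance⟩
        exact ShortComplex.isoMk (Iso.refl _) (Iso.refl _) (Iso.refl _)
          ((Category.id_comp _).trans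
            ((Category.comp_id _).trans (ofPresentationComplex_d_one_zero f)).symm)
          ((Category.id_comp _).trans ((Category.comp_id _).trans
            (ChainComplex.toSingle₀Equiv_symm_apply_f_zero (C := ofPresentationComplex f)
              (cokernel.π f) _)).symm)
      all_goals rfl
    · rw [quasiIsoAt_iff_exactAt']
      · apply ofPresentationComplex_exactAt_succ
      · apply ChainComplex.exactAt_succ_single_obj⟩

end CategoryTheory.ProjectiveResolution

namespace CategoryTheory.Functor

open ProjectiveResolution

variable {C D : Type*} [Category* C] [Abelian C] [EnoughProjectives C] [Category* D] [Abelian D]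
  (F : C ⥤ D) [F.Additive] {P₁ P₀ : C} (f : P₁ ⟶ P₀) [Projective P₁] [Projective P₀]

/-- Computing with a resolution whose first differential is `f` itself lets hypotheses on `F.map f`
be used directly. -/
lemma isZero_leftDerived_succ_cokernel_iff (n : ℕ) :
    IsZero ((F.leftDerived (n + 1)).obj (cokernel f)) ↔
      (((F.mapHomologicalComplex _).obj (ofPresentationComplex f)).sc' (n + 2) (n + 1) n).Exact := by
  rw [← HomologicalComplex.exactAt_iff' _ (n + 1 + 1) (n + 1) n (by simp) (by simp),
    HomologicalComplex.exactAt_iff_isZero_homology]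
  exact ((ofPresentation f).isoLeftDerivedObj F (n + 1)).isZero_iff

omit [Projective P₁] [Projective P₀] in
lemma map_d_two_one_eq_zero [Mono (F.map f)] :
    F.map ((ofPresentationComplex f).d 2 1) = 0 := by
  have h : F.map ((ofPresentationComplex f).d 2 1) ≫ F.map f = 0 := by
    refine (F.map_comp _ _).symm.trans ?_
    rw [ofPresentationComplex_d_two_one]
    exact (congrArg F.map (d_comp_self f)).trans (F.map_zero _ _)
  exact (cancel_mono (F.map f)).1 (h.trans zero_comp.symm)

/-- If `F f` is a monomorphism, then the first left derived functor vanishes on `coker f`. -/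
lemma isZero_leftDerived_one_cokernel [hf : Mono (F.map f)] :
    IsZero ((F.leftDerived 1).obj (cokernel f)) := by
  rw [isZero_leftDerived_succ_cokernel_iff, ShortComplex.exact_iff_mono]
  · change Mono (F.map ((ofPresentationComplex f).d 1 0))
    rwa [ofPresentationComplex_d_one_zero]
  · exact F.map_d_two_one_eq_zero f

/-- If `F f` is a monomorphism and the second left derived functor of `F` vanishes on `coker f`,
then `F` kills the kernel of `f`. -/
lemma isZero_obj_kernel_of_isZero_leftDerived_two [F.PreservesEpimorphisms] [Mono (F.map f)]
    (h : IsZero ((F.leftDerived 2).obj (cokernel f))) : IsZero (F.obj (Limits.kernel f)) := by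
  -- The map leaving degree 2 vanishes under `F`, so exactness there says that the incoming map is
  -- epi.
  rw [isZero_leftDerived_succ_cokernel_iff,
    ShortComplex.exact_iff_epi _ (F.map_d_two_one_eq_zero f)] at h
  let p : (ofPresentationComplex f).X 2 ⟶ Limits.kernel f := Projective.π (Limits.kernel f)
  have hp : Epi p := inferInstanceAs (Epi (Projective.π (Limits.kernel f)))
  have hpι : p ≫ kernel.ι f = (ofPresentationComplex f).d 2 1 :=
    (ofPresentationComplex_d_two_one f).symm
  have hdp : (ofPresentationComplex f).d 3 2 ≫ p = 0 := by
    rw [← cancel_mono (kernel.ι f), Category.assoc, hpι, zero_comp]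
    exact HomologicalComplex.d_comp_d _ 3 2 1
  have hd : Epi (F.map ((ofPresentationComplex f).d 3 2)) := h
  -- `F.map p` is both zero and epi, so its target vanishes.
  have h0 : F.map p = 0 := by
    rw [← cancel_epi (F.map ((ofPresentationComplex f).d 3 2)), ← F.map_comp, hdp, F.map_zero,
      comp_zero]
  have : Epi (F.map p) := inferInstance
  exact IsZero.of_epi_eq_zero _ h0

end CategoryTheory.Functor

/-- By Nakayama both modules stay nonzero over the residue field `k`, and `k ⊗ (M ⊗ N)` is the
tensor product over `k` of two nonzero vector spaces. -/
lemma IsLocalRing.nontrivial_tensorProduct (R M N : Type*) [CommRing R] [IsLocalRing R]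
    [AddCommGroup M] [Module R M] [Module.Finite R M] [Nontrivial M]
    [AddCommGroup N] [Module R N] [Module.Finite R N] [Nontrivial N] :
    Nontrivial (TensorProduct R M N) := by
  let k := IsLocalRing.ResidueField R
  have hM : Nontrivial (TensorProduct R k M) := by
    rwa [← not_subsingleton_iff_nontrivial, IsLocalRing.subsingleton_tensorProduct,
      not_subsingleton_iff_nontrivial]
  have hN : Nontrivial (TensorProduct R k N) := by
    rwa [← not_subsingleton_iff_nontrivial, IsLocalRing.subsingleton_tensorProduct,
      not_subsingleton_iff_nontrivial]
  have h : Nontrivial (TensorProduct R k (TensorProduct R M N)) :=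
    (TensorProduct.AlgebraTensorModule.distribBaseChange R k M N).toEquiv.nontrivial
  by_contra hs
  rw [not_nontrivial_iff_subsingleton] at hs
  exact not_subsingleton (TensorProduct R k (TensorProduct R M N)) inferInstance

/-- A nonzerodivisor on a Tor-rigid module is a nonzerodivisor of the ring. -/
lemma IsTorRigid.mem_nonZeroDivisors {R M : Type u} [CommRing R] [IsLocalRing R]
    [IsNoetherianRing R] [AddCommGroup M] [Module R M] [Module.Finite R M] [Nontrivial M]
    (hM : IsTorRigid R M) {x : R} (hx : IsSMulRegular M x) : x ∈ nonZeroDivisors R := by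
  let f : ModuleCat.of R R ⟶ ModuleCat.of R R := ModuleCat.ofHom (LinearMap.lsmul R R x)
  let F := (MonoidalCategory.tensoringLeft (ModuleCat.{u} R)).obj (ModuleCat.of R M)
  have hproj : Projective (ModuleCat.of R R) :=
    ModuleCat.projective_of_free (Module.Basis.singleton PUnit.{1} R)
  have hFf : Mono (F.map f) := by
    rw [ModuleCat.mono_iff_injective]
    have h : ∀ t : TensorProduct R M R, (F.map f).hom t = x • t := by
      intro t
      induction t with
      | zero => simp
      | tmul m r => exact TensorProduct.tmul_smul x m r
      | add a b ha hb => rw [map_add, ha, hb, smul_add]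
    intro a b hab
    have hab' : x • (a : TensorProduct R M R) = x • b := by rw [← h, ← h]; exact hab
    apply (TensorProduct.rid R M).injective
    apply hx
    simpa using congrArg (TensorProduct.rid R M) hab'
  have hfin : Module.Finite R (cokernel f : ModuleCat R) :=
    Module.Finite.of_surjective (cokernel.π f).hom
      ((ModuleCat.epi_iff_surjective _).1 inferInstance)
  have hfinK : Module.Finite R (kernel f : ModuleCat R) :=
    Module.Finite.of_injective (kernel.ι f).hom
      ((ModuleCat.mono_iff_injective _).1 inferInstance)
  -- Rigidity passes from `Tor₁` to `Tor₂` of `cokernel f = R/xR`; `kernel f` is `(0 : x)`.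
  have hK := F.isZero_obj_kernel_of_isZero_leftDerived_two f
    (hM (cokernel f : ModuleCat R) 1 (F.isZero_leftDerived_one_cokernel f) 2 one_le_two)
  have hK' : Subsingleton (TensorProduct R M (kernel f : ModuleCat R)) :=
    ModuleCat.subsingleton_of_isZero hK
  have hsub : Subsingleton (kernel f : ModuleCat R) := by
    by_contra h
    rw [not_subsingleton_iff_nontrivial] at h
    exact not_nontrivial_iff_subsingleton.2 hK' (IsLocalRing.nontrivial_tensorProduct R M _)
  have hmono : Mono f := Preadditive.mono_of_isZero_kernel f (ModuleCat.isZero_of_subsingleton _)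
  rw [ModuleCat.mono_iff_injective] at hmono
  refine mem_nonZeroDivisors_iff_right.2 fun y hy => hmono (a₁ := y) (a₂ := 0) ?_
  simpa [f, mul_comm] using hy

/-- A local module whose maximal ideal is associated has depth zero. -/
lemma moduleDepth_eq_zero_of_mem_associatedPrimes {R M : Type*} [CommRing R] [IsLocalRing R]
    [IsNoetherianRing R] [AddCommGroup M] [Module R M]
    (h : IsLocalRing.maximalIdeal R ∈ associatedPrimes R M) : moduleDepth R M = 0 := by
  obtain ⟨-, y, hy⟩ := isAssociatedPrime_iff.1 h
  have hy0 : y ≠ 0 := by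
    rintro rfl
    exact Ideal.IsPrime.ne_top inferInstance (hy.trans (by simp))
  simp only [moduleDepth, ← nonpos_iff_eq_zero, iSup_le_iff]
  rintro (_ | ⟨r, rs⟩) ⟨hrs, hreg⟩
  · simp
  · rw [RingTheory.Sequence.isWeaklyRegular_cons_iff] at hreg
    have hr : r • y = 0 := by
      have := hrs r (by simp)
      rw [hy] at this
      simpa [Submodule.mem_colon_singleton] using this
    exact absurd (hreg.1.right_eq_zero_of_smul hr) hy0

/-- A module satisfying Serre's condition `(Sₙ)` with `n > 0` has no embedded primes: all its
associated primes are minimal primes of the ring. -/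
lemma SatisfiesSerre.associatedPrimes_subset_minimalPrimes {R M : Type*} [CommRing R]
    [IsNoetherianRing R] [AddCommGroup M] [Module R M] {n : ℕ} (hn : 0 < n)
    (hM : SatisfiesSerre R M n) : associatedPrimes R M ⊆ minimalPrimes R := by
  intro q hq
  have : q.IsPrime := hq.isPrime
  have hq' := Module.associatedPrimes.mem_associatedPrimes_atPrime_of_mem_associatedPrimes hq
  have hsupp : (⟨q, this⟩ : PrimeSpectrum R) ∈ Module.support R M := by
    rw [Module.mem_support_iff]
    by_contra hs
    rw [not_nontrivial_iff_subsingleton] at hs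
    exact not_isAssociatedPrime_of_subsingleton hq'
  have h := hM _ hsupp
  rw [moduleDepth_eq_zero_of_mem_associatedPrimes hq',
    IsLocalization.AtPrime.ringKrullDim_eq_height q] at h
  rw [← Ideal.height_eq_zero_iff]
  -- The depth at `q` is zero, so `min n (height q) ≤ 0`; as `n > 0`, the height is zero.
  rcases min_le_iff.1 h with h | h
  · norm_cast at h; omega
  · simpa using h

theorem corollary2p7 (R M : Type u) [CommRing R] [IsLocalRing R] [AddCommGroup M] [Module R M]
    [Module.Finite R M] [Nontrivial M] (hR : IsCohenMacaulayLocal R) (hM : SatisfiesSerre R M 3)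
    (hp : ∃ p : PrimeSpectrum R, p.asIdeal.height = 2 ∧ p ∉ Module.support R M) :
    ¬ IsTorRigid R M := by
  intro hrig
  have := hR.isNoetherianRing
  obtain ⟨p, -, hp⟩ := hp
  obtain ⟨q, hq, hqp⟩ := Ideal.exists_minimalPrimes_le (bot_le : ⊥ ≤ p.asIdeal)
  have hqprime : q.IsPrime := hq.1.1
  have hdisj : ∀ r ∈ q, ∃ I ∈ associatedPrimes R M, r ∈ I := by
    intro r hr
    by_contra hcon
    refine Set.disjoint_left.1 (Ideal.disjoint_nonZeroDivisors_of_mem_minimalPrimes hq) hr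
      (hrig.mem_nonZeroDivisors ?_)
    rw [isSMulRegular_iff_right_eq_zero_of_smul]
    intro m hm
    by_contra hm0
    have hmem : r ∈ ⋃ I ∈ associatedPrimes R M, (I : Set R) := by
      rw [biUnion_associatedPrimes_eq_zero_divisors]
      exact ⟨m, hm0, hm⟩
    simp only [Set.mem_iUnion] at hmem
    obtain ⟨I, hI, hrI⟩ := hmem
    exact hcon ⟨I, hI, hrI⟩
  -- Prime avoidance tolerates two non-prime indices; all ideals here are prime, so the choice `0 0`
  -- is arbitrary.
  obtain ⟨I, hI, hqI⟩ := (q.subset_union_prime_finite (associatedPrimes.finite R M) (f := id) 0 0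
    fun _ h _ _ ↦ h.isPrime).1 fun r hr ↦ by simpa using hdisj r hr
  have hIq : I ≤ q := (hM.associatedPrimes_subset_minimalPrimes (by norm_num) hI).2 hq.1 hqI
  refine hp (Module.support_eq_zeroLocus (R := R) (M := M) ▸ ?_)
  rw [PrimeSpectrum.mem_zeroLocus, SetLike.coe_subset_coe, ← Submodule.annihilator_top]
  exact (hI.annihilator_le.trans hIq).trans hqp
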